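/- Let $A$ be a finitely generated $\mathbb C$-algebra which is an integral domain, let $x\in A$ be a prime element, let $\nu\ge 1$ and $\ell_0,\dots,\ell_{\nu-1}\ge 1$ be integers, and let $g_0=g(Z)\in A[Z]\setminus A$ and $g_i=g_i(Z,Y_1,\dots,Y_i)\in A[Z,Y_1,\dots,Y_i]\setminus A[Z,Y_1,\dots,Y_{i-1}]$ for $0<i<\nu$ (where $A[Z,Y_1,\dots,Y_{i-1}]=A[Z]$ if $i=1$). Put $$B=A[Z,Y_1,\dots,Y_\nu]/\bigl(x^{\ell_0}Y_1-g_0,\;x^{\ell_1}Y_2-g_1,\;\dots,\;x^{\ell_{\nu-1}}Y_\nu-g_{\nu-1}\bigr),$$ let $z,y_1,\dots,y_\nu\in B$ be the residue classes of $Z,Y_1,\dots,Y_\nu$, and let $\pi:\operatorname{Spec}B\to\operatorname{Spec}A$ be the morphism defined by $A\to B$. Suppose that $B$ is a factorial domain and is faithfully flat over $A$, and that $A$ is factorially closed in $B$, i.e. $b_1,b_2\in B$ and $b_1b_2\in A\setminus\{0\}$ imply $b_1,b_2\in A$. Suppose moreover that $z-a\notin xB$ for every $a\in A$, and that $\partial_{y_{\nu-1}}g_{\nu-1}\notin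 xB$, where $\partial_{y_{\nu-1}}g_{\nu-1}\in B$ is the residue class of $\partial g_{\nu-1}/\partial Y_{\nu-1}$ (of $g'(Z)$ if $\nu=1$). Then there are an integer $m>1$ and a dense open subset $U$ of $V_Y(x)=\operatorname{Spec}A/xA$ such that, for every closed point $Q\in U$, the scheme-theoretic fiber over $Q$ of the restriction $\pi|_{V(x)}:\operatorname{Spec}B/xB\to\operatorname{Spec}A/xA$ is isomorphic, over the residue field of $Q$, to a disjoint union of $m$ affine lines. Moreover, $\pi$ is not a trivial $\mathbb A^1$-bundle, i.e. $\operatorname{Spec}B$ is not isomorphic to $\mathbb A^1\times\operatorname{Spec}A$ over $\operatorname{Spec}A$. -/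

import Mathlib

universe u

noncomputable section

open CategoryTheory CategoryTheory.Limits AlgebraicGeometry

/-- The ideal of `A[Z, Y₁, …, Y_ν]` generated by the `ν` polynomials
`x ^ ℓ₀ * Y₁ - g₀, …, x ^ ℓ_{ν-1} * Y_ν - g_{ν-1}`. The variable with index `0` is `Z`
and the variable with index `i ≥ 1` is `Y_i`. -/
def towerIdeal {A : Type u} [CommRing A] {ν : ℕ} (x : A) (l : Fin ν → ℕ)
    (g : Fin ν → MvPolynomial (Fin (ν + 1)) A) : Ideal (MvPolynomial (Fin (ν + 1)) A) :=
  Ideal.span (Set.range fun i : Fin ν =>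
    MvPolynomial.C (x ^ l i) * MvPolynomial.X i.succ - g i)

/-- The `A`-algebra `B = A[Z, Y₁, …, Y_ν] / I`. -/
abbrev TowerRing {A : Type u} [CommRing A] {ν : ℕ} (x : A) (l : Fin ν → ℕ)
    (g : Fin ν → MvPolynomial (Fin (ν + 1)) A) : Type u :=
  MvPolynomial (Fin (ν + 1)) A ⧸ towerIdeal x l g

/-- The residue class in `B` of a polynomial in `Z, Y₁, …, Y_ν`. -/
abbrev TowerRing.mk {A : Type u} [CommRing A] {ν : ℕ} (x : A) (l : Fin ν → ℕ)
    (g : Fin ν → MvPolynomial (Fin (ν + 1)) A) :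
    MvPolynomial (Fin (ν + 1)) A →ₐ[A] TowerRing x l g :=
  Ideal.Quotient.mkₐ A (towerIdeal x l g)

/-- `A` is factorially closed in `B`: a nonzero product lying in (the image of) `A` has
both factors in `A`. -/
def IsFactoriallyClosed (A B : Type u) [CommRing A] [CommRing B] [Algebra A B] : Prop :=
  ∀ b₁ b₂ : B, b₁ * b₂ ≠ 0 → b₁ * b₂ ∈ (algebraMap A B).range →
    b₁ ∈ (algebraMap A B).range ∧ b₂ ∈ (algebraMap A B).range

/-- The morphism `π : Spec B ⟶ Spec A` given by the structure map of the `A`-algebra `B`. -/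
def structureMorphism (A B : Type u) [CommRing A] [CommRing B] [Algebra A B] :
    Spec (CommRingCat.of B) ⟶ Spec (CommRingCat.of A) :=
  Spec.map (CommRingCat.ofHom (algebraMap A B))

/-- The restriction `π|_{V(x)} : V(x) = Spec (B / xB) ⟶ V_Y(x) = Spec (A / xA)`. -/
def restrictedMorphism (A B : Type u) [CommRing A] [CommRing B] [Algebra A B] (x : A) :
    Spec (CommRingCat.of (B ⧸ (Ideal.span {x}).map (algebraMap A B))) ⟶
      Spec (CommRingCat.of (A ⧸ Ideal.span {x})) :=
  Spec.map (CommRingCat.ofHom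
    (Ideal.quotientMap ((Ideal.span {x}).map (algebraMap A B)) (algebraMap A B)
      Ideal.le_comap_map))

/-- The affine line over a scheme. -/
abbrev affineLine (S : Scheme.{u}) : Scheme.{u} := 𝔸(PUnit.{u + 1}; S)

/-- `f : X ⟶ Y` is a trivial `𝔸¹`-bundle: `X` is isomorphic over `Y` to `Y × 𝔸¹`. -/
def IsTrivialAffineLineBundle {X Y : Scheme.{u}} (f : X ⟶ Y) : Prop :=
  ∃ e : X ≅ affineLine Y, e.hom ≫ (affineLine Y ↘ Y) = f

/-- The `S`-scheme `f : F ⟶ S` is isomorphic over `S` to the disjoint union of `m` copies of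
the affine line over `S`. -/
def IsDisjointUnionOfAffineLines {F S : Scheme.{u}} (m : ℕ) (f : F ⟶ S) : Prop :=
  ∃ e : F ≅ ∐ (fun _ : Fin m => affineLine S),
    e.hom ≫ Sigma.desc (fun _ : Fin m => (affineLine S ↘ S)) = f

/-- A general (closed) fiber of `f` is a disjoint union of `m` affine lines: there is a dense
open subset of the target such that the scheme-theoretic fiber over each of its points that is
closed in the target is a disjoint union of `m` affine lines over the residue field. -/
def GeneralFiberIsDisjointUnionOfAffineLines {X Y : Scheme.{u}} (m : ℕ) (f : X ⟶ Y) : Prop :=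
  ∃ U : Y.Opens, Dense (U : Set Y) ∧
    ∀ y ∈ U, IsClosed ({y} : Set Y) → IsDisjointUnionOfAffineLines m (f.fiberToSpecResidueField y)

end

/-!
Write `D = A / xA` and `C = B / xB`. As `B` is factorial, faithfully flat over `A`, and `A` is
factorially closed in it, `x` remains prime in `B` (`prime_algebraMap_of_isFactoriallyClosed`), so
`C` is a domain containing `D`. The last variable `Y_ν` occurs in none of the `g i`, hence `C =
R[Y_ν]` with `R = D[Z, Y₁, …, Y_{ν-1}] / (g₀, …, g_{ν-1})` (`exists_reductionMod_algEquiv`).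

The main point is that `R` is algebraic over `D`. Elements of `B` whose classes in `C` are
algebraically independent over `D` are algebraically independent over `A`, because a relation over
`A` can be divided by `x` until its reduction is nonzero; hence `trdeg_D R + 1 = trdeg_D C ≤
trdeg_A B ≤ 1`, the last inequality because each `Y_i` is algebraic over `A[Z]`.

So `R` is a domain of finite type, algebraic over the domain `D` of characteristic zero. After
inverting some `f ≠ 0` in `D` it is free of some rank `m` and its module of differentials
vanishes. Hence over every algebraically closed field `k` in which `f` is invertible, `k ⊗ R` is
an étale `k`-algebra of dimension `m`, that is, `k ^ m`, and `k ⊗ C` is `(k[Y]) ^ m`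
(`exists_forall_nonempty_tensorProduct_algEquiv_pi`). By the Nullstellensatz this applies to the
closed points of `D(f)`.

If `m` were at most `1`, then `s z = r` in `C` for some `r, s ∈ D` with `s ≠ 0`, and faithful
flatness would give `z ∈ A + xB`, which is excluded. If `B` were a polynomial ring over `A`, then
`C ≅ D[T]`, where only constants are algebraic over `D`; as `z` is algebraic, again `z ∈ A + xB`.
-/

noncomputable section

open CategoryTheory CategoryTheory.Limits AlgebraicGeometry
open scoped TensorProduct

/-! ### Algebraic algebras of finite type over a domain -/

section GenericallyFinite

variable (D R : Type*) [CommRing D] [CommRing R] [Algebra D R]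

variable {D R} in
/-- Linear independence over `D` passes to the fraction fields `K` and `L`, where all of `R` lies in a
finite-dimensional `K`-subspace of `L`. -/
theorem finite_of_linearIndependent_of_isAlgebraic [IsDomain D] [IsDomain R]
    [Algebra.FiniteType D R] [Algebra.IsAlgebraic D R]
    (K L : Type*) [Field K] [Field L] [Algebra D K] [IsFractionRing D K] [Algebra R L]
    [IsFractionRing R L] [Algebra K L] [Algebra D L] [IsScalarTower D K L] [IsScalarTower D R L]
    {ι : Type*} {v : ι → R} (hv : LinearIndependent D v) : Finite ι := by
  obtain ⟨t, ht⟩ := Algebra.FiniteType.out (R := D) (A := R)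
  -- the `K`-subalgebra of `L` generated by `R` is finite and contains the linearly
  -- independent family
  let S : Subalgebra K L := Algebra.adjoin K (algebraMap R L '' t)
  have hS : (Subalgebra.toSubmodule S).FG := by
    refine fg_adjoin_of_finite (t.finite_toSet.image _) ?_
    rintro _ ⟨r, -, rfl⟩
    have h1 : IsAlgebraic D (algebraMap R L r) :=
      (Algebra.IsAlgebraic.isAlgebraic (R := D) r).algebraMap
    exact (h1.extendScalars (IsFractionRing.injective D K)).isIntegral
  have hmem : ∀ r : R, algebraMap R L r ∈ S := by
    intro r
    have hr : r ∈ Algebra.adjoin D (t : Set R) := by rw [ht]; trivial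
    induction hr using Algebra.adjoin_induction with
    | mem x hx => exact Algebra.subset_adjoin ⟨x, hx, rfl⟩
    | algebraMap d =>
      rw [← IsScalarTower.algebraMap_apply D R L, IsScalarTower.algebraMap_apply D K L]
      exact S.algebraMap_mem _
    | add a b _ _ ha hb => rw [map_add]; exact S.add_mem ha hb
    | mul a b _ _ ha hb => rw [map_mul]; exact S.mul_mem ha hb
  have : Module.Finite K S := ⟨(Submodule.fg_top _).2 hS⟩
  have hli : LinearIndependent D (fun i => algebraMap R L (v i)) :=
    LinearIndependent.map' hv (IsScalarTower.toAlgHom D R L).toLinearMap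
      (LinearMap.ker_eq_bot.2 (IsFractionRing.injective R L))
  have hli' : LinearIndependent K (fun i => algebraMap R L (v i)) :=
    (LinearIndependent.iff_fractionRing D K).1 hli
  have hli'' : LinearIndependent K (fun i => (⟨algebraMap R L (v i), hmem (v i)⟩ : S)) :=
    LinearIndependent.of_comp S.val.toLinearMap hli'
  exact hli''.finite

/-- A finite type algebraic domain over `D` is free after inverting a nonzero `f`. The family `b`
is a maximal linearly independent one, and `f` is chosen to move `1` and the products of the
members of `b` with the generators of `R` into its span. -/
theorem exists_linearIndependent_span_away [IsDomain D] [IsDomain R] [FaithfulSMul D R]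
    [Algebra.FiniteType D R] [Algebra.IsAlgebraic D R] :
    ∃ (m : ℕ) (b : Fin m → R) (f : D), f ≠ 0 ∧ LinearIndependent D b ∧
      ∀ r : R, ∃ n : ℕ, f ^ n • r ∈ Submodule.span D (Set.range b) := by
  classical
  obtain ⟨I, hI, hmax⟩ := exists_maximal_linearIndepOn D (id : R → R)
  obtain ⟨t, ht⟩ := Algebra.FiniteType.out (R := D) (A := R)
  have hfin : I.Finite := by
    let : Algebra (FractionRing D) (FractionRing R) := FractionRing.liftAlgebra D (FractionRing R)
    have : IsScalarTower D (FractionRing D) (FractionRing R) :=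
      FractionRing.isScalarTower_liftAlgebra D (FractionRing R)
    have : Finite I := finite_of_linearIndependent_of_isAlgebraic (FractionRing D)
      (FractionRing R) (hI : LinearIndependent D _)
    exact Set.toFinite I
  have hmult : ∀ r : R, ∃ a : D, a ≠ 0 ∧ a • r ∈ Submodule.span D I := by
    intro r
    by_cases hr : r ∈ I
    · exact ⟨1, one_ne_zero, by simpa using Submodule.subset_span hr⟩
    · simpa using hmax r hr
  -- a common multiplier for a finite set of elements
  have hcommon : ∀ s : Finset R, ∃ a : D, a ≠ 0 ∧ ∀ r ∈ s, a • r ∈ Submodule.span D I := by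
    intro s
    induction s using Finset.induction with
    | empty => exact ⟨1, one_ne_zero, by simp⟩
    | insert r s _ ih =>
      obtain ⟨a, ha, has⟩ := ih
      obtain ⟨c, hc, hcr⟩ := hmult r
      refine ⟨a * c, mul_ne_zero ha hc, ?_⟩
      intro q hq
      rcases Finset.mem_insert.1 hq with rfl | hq
      · rw [mul_smul]; exact Submodule.smul_mem _ _ hcr
      · rw [mul_comm, mul_smul]; exact Submodule.smul_mem _ _ (has q hq)
  obtain ⟨f, hf, hfs⟩ := hcommon
    (insert 1 (Finset.image₂ (fun a b => a * b) t hfin.toFinset))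
  have h1 : f • (1 : R) ∈ Submodule.span D I := hfs 1 (Finset.mem_insert_self _ _)
  have hgen : ∀ a ∈ t, ∀ q ∈ Submodule.span D I, f • (a * q) ∈ Submodule.span D I := by
    intro a ha q hq
    induction hq using Submodule.span_induction with
    | mem q hq =>
      exact hfs _ (Finset.mem_insert_of_mem
        (Finset.mem_image₂_of_mem ha (hfin.mem_toFinset.2 hq)))
    | zero => simp
    | add p q _ _ hp hq => rw [mul_add, smul_add]; exact Submodule.add_mem _ hp hq
    | smul d q _ hq => rw [mul_smul_comm, smul_comm]; exact Submodule.smul_mem _ _ hq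
  have hstab : ∀ a : R, ∃ n : ℕ, 
      ∀ q ∈ Submodule.span D I, f ^ n • (a * q) ∈ Submodule.span D I := by
    intro a
    have hr : a ∈ Algebra.adjoin D (t : Set R) := by rw [ht]; trivial
    induction hr using Algebra.adjoin_induction with
    | mem x hx => exact ⟨1, by simpa using hgen x hx⟩
    | algebraMap d =>
      refine ⟨0, fun q hq => ?_⟩
      rw [pow_zero, one_smul, ← Algebra.smul_def]
      exact Submodule.smul_mem _ _ hq
    | add a b _ _ ha hb =>
      obtain ⟨n, hn⟩ := ha
      obtain ⟨p, hp⟩ := hb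
      refine ⟨n + p, fun q hq => ?_⟩
      rw [add_mul, smul_add]
      refine Submodule.add_mem _ ?_ ?_
      · rw [add_comm, pow_add, mul_smul]; exact Submodule.smul_mem _ _ (hn q hq)
      · rw [pow_add, mul_smul]; exact Submodule.smul_mem _ _ (hp q hq)
    | mul a b _ _ ha hb =>
      obtain ⟨n, hn⟩ := ha
      obtain ⟨p, hp⟩ := hb
      refine ⟨n + p, fun q hq => ?_⟩
      have := hn _ (hp q hq)
      rwa [mul_smul_comm, smul_smul, ← pow_add, ← mul_assoc] at this
  have := hfin.fintype
  let e : Fin (Fintype.card I) ≃ I := (Fintype.equivFin I).symm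
  refine ⟨Fintype.card I, fun i => (e i : R), f, hf,
    (LinearIndependent.comp (hI : LinearIndependent D _) e e.injective), fun r => ?_⟩
  have hrange : Set.range (fun i => (e i : R)) = I := by
    ext q
    constructor
    · rintro ⟨i, rfl⟩; exact (e i).2
    · intro hq; exact ⟨e.symm ⟨q, hq⟩, by simp⟩
  rw [hrange]
  obtain ⟨n, hn⟩ := hstab r
  refine ⟨n + 1, ?_⟩
  have := hn _ h1
  rwa [mul_smul_comm, mul_one, smul_smul, ← pow_succ] at this

/-- If `p` is a relation of least degree for `a`, then `p'(a) da = 0`, and in characteristic zero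
`p'(a)` is nonzero, so that it divides a nonzero element of `D`. -/
theorem exists_smul_kaehlerDifferential_eq_zero [IsDomain D] [IsDomain R] [FaithfulSMul D R]
    [CharZero D] [Algebra.FiniteType D R] [Algebra.IsAlgebraic D R] :
    ∃ f : D, f ≠ 0 ∧ ∀ w : Ω[R⁄D], f • w = 0 := by
  classical
  have key : ∀ a : R, ∃ f : D, f ≠ 0 ∧ f • KaehlerDifferential.D D R a = 0 := by
    intro a
    obtain ⟨p, ⟨hp0, hpa⟩, hmin⟩ := exists_minimalFor_of_wellFoundedLT
      (fun p : Polynomial D => p ≠ 0 ∧ Polynomial.aeval a p = 0) Polynomial.natDegree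
      (Algebra.IsAlgebraic.isAlgebraic (R := D) a)
    have hdeg : p.natDegree ≠ 0 := by
      intro h0
      rw [Polynomial.eq_C_of_natDegree_eq_zero h0, Polynomial.aeval_C,
        FaithfulSMul.algebraMap_eq_zero_iff] at hpa
      exact hp0 (by rw [Polynomial.eq_C_of_natDegree_eq_zero h0, hpa, map_zero])
    have hda : Polynomial.aeval a (Polynomial.derivative p) ≠ 0 := by
      intro h
      have hlt := Polynomial.natDegree_derivative_lt hdeg
      have hne : Polynomial.derivative p ≠ 0 := fun h0 =>
        hdeg (Polynomial.derivative_eq_zero.1 h0)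
      exact absurd (hmin ⟨hne, h⟩ hlt.le) (not_le.2 hlt)
    obtain ⟨f, hf, q, hq⟩ := (Algebra.IsAlgebraic.isAlgebraic (R := D)
      (Polynomial.aeval a (Polynomial.derivative p))).exists_nonzero_dvd
        (mem_nonZeroDivisors_of_ne_zero hda)
    refine ⟨f, hf, ?_⟩
    have hD : Polynomial.aeval a (Polynomial.derivative p) • KaehlerDifferential.D D R a = 0 := by
      rw [← Derivation.map_aeval, hpa, map_zero]
    rw [← algebraMap_smul R f, hq, mul_comm, mul_smul, hD, smul_zero]
  obtain ⟨t, ht⟩ := Algebra.FiniteType.out (R := D) (A := R)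
  choose φ hφ0 hφ using key
  refine ⟨∏ a ∈ t, φ a, Finset.prod_ne_zero_iff.2 fun a _ => hφ0 a, ?_⟩
  have hkill : ∀ a : R, (∏ a ∈ t, φ a) • KaehlerDifferential.D D R a = 0 := by
    intro a
    have hr : a ∈ Algebra.adjoin D (t : Set R) := by rw [ht]; trivial
    induction hr using Algebra.adjoin_induction with
    | mem x hx => rw [← Finset.prod_erase_mul _ _ hx, mul_smul, hφ, smul_zero]
    | algebraMap d => rw [Derivation.map_algebraMap, smul_zero]
    | add a b _ _ ha hb => rw [map_add, smul_add, ha, hb, add_zero]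
    | mul a b _ _ ha hb =>
      rw [Derivation.leibniz, smul_add, smul_comm _ a, smul_comm _ b, ha, hb, smul_zero, smul_zero,
        add_zero]
  intro w
  have hw : w ∈ Submodule.span R (Set.range (KaehlerDifferential.D D R)) := by
    rw [KaehlerDifferential.span_range_derivation]; trivial
  induction hw using Submodule.span_induction with
  | mem w hw => obtain ⟨a, rfl⟩ := hw; exact hkill a
  | zero => simp
  | add v w _ _ hv hw => rw [smul_add, hv, hw, add_zero]
  | smul a w _ hw => rw [smul_comm, hw, smul_zero]

end GenericallyFinite

section Specialization

variable {D R : Type*} [CommRing D] [CommRing R] [Algebra D R] (k : Type*) [Field k] [Algebra D k]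

/-- A family that is a basis after inverting `f` remains one over every field in which `f` is
invertible: its span is everything, and its coordinate functions, which have values in the
localization of `D` at `f`, specialize to `k`. -/
theorem finrank_tensorProduct_of_span_away [IsDomain D] [IsDomain R] [FaithfulSMul D R] {m : ℕ}
    {b : Fin m → R} {f : D} (hb : LinearIndependent D b)
    (hspan : ∀ r : R, ∃ n : ℕ, f ^ n • r ∈ Submodule.span D (Set.range b))
    (hfk : algebraMap D k f ≠ 0) :
    Module.Finite k (k ⊗[D] R) ∧ Module.finrank k (k ⊗[D] R) = m := by
  classical
  have hf : f ≠ 0 := fun h => hfk (by rw [h, map_zero])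
  let S := Submonoid.powers f
  let u : (Fin m → D) →ₗ[D] R := Fintype.linearCombination D b
  have hu : Function.Injective u := linearIndependent_iff_injective_fintypeLinearCombination.1 hb
  have hrange : ∀ r : R, ∃ (n : ℕ) (v : Fin m → D), u v = f ^ n • r := by
    intro r
    obtain ⟨n, hn⟩ := hspan r
    rw [← Fintype.range_linearCombination] at hn
    exact ⟨n, hn⟩
  have hS : ∀ s : S, (s : D) ≠ 0 := by
    rintro ⟨_, n, rfl⟩; exact pow_ne_zero _ hf
  let mk := LocalizedModule.mkLinearMap S R
  have hmk : Function.Injective mk := by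
    intro a c hac
    obtain ⟨s, hs⟩ := IsLocalizedModule.exists_of_eq (S := S) hac
    exact smul_right_injective R (hS s) hs
  have hloc : IsLocalizedModule S (mk ∘ₗ u) := by
    refine ⟨fun s => IsLocalizedModule.map_units mk s, fun y => ?_, fun {v w} hvw => ?_⟩
    · obtain ⟨⟨r, s⟩, hrs⟩ := IsLocalizedModule.surj S mk y
      obtain ⟨n, v, hv⟩ := hrange r
      refine ⟨⟨v, ⟨f ^ n, n, rfl⟩ * s⟩, ?_⟩
      rw [mul_smul, hrs, LinearMap.comp_apply, hv, map_smul]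
      rfl
    · exact ⟨1, by rw [hu (hmk hvw)]⟩
  -- the coordinates with respect to `b`, specialized to `k`
  let red : (Fin m → D) →ₗ[D] (Fin m → k) := (Algebra.linearMap D k).compLeft (Fin m)
  have hunit : ∀ s : S, IsUnit (algebraMap D (Module.End D (Fin m → k)) s) := by
    rintro ⟨_, n, rfl⟩
    rw [Module.End.isUnit_iff]
    have hne : algebraMap D k (f ^ n) ≠ 0 := by rw [map_pow]; exact pow_ne_zero _ hfk
    refine ⟨fun v w hvw => ?_, fun v => ⟨fun i => (algebraMap D k (f ^ n))⁻¹ * v i, ?_⟩⟩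
    · funext i
      have := congrFun hvw i
      simp only [Module.algebraMap_end_apply, Pi.smul_apply, Algebra.smul_def] at this
      exact mul_left_cancel₀ hne this
    · funext i
      simp only [Module.algebraMap_end_apply, Pi.smul_apply, Algebra.smul_def]
      rw [mul_inv_cancel_left₀ hne]
  let ρ : R →ₗ[D] (Fin m → k) := IsLocalizedModule.lift S (mk ∘ₗ u) red hunit ∘ₗ mk
  have hρ : ∀ v, ρ (u v) = red v := fun v =>
    IsLocalizedModule.lift_apply S (mk ∘ₗ u) red hunit v
  let ρk : k ⊗[D] R →ₗ[k] (Fin m → k) := ρ.liftBaseChange k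
  have hub : ∀ i, u (Pi.single i 1) = b i := fun i => by simp [u]
  have hρb : ∀ i, ρk (1 ⊗ₜ b i) = Pi.single i 1 := by
    intro i
    rw [LinearMap.liftBaseChange_tmul, one_smul, ← hub, hρ]
    funext j
    by_cases hij : j = i
    · subst hij; simp [red]
    · simp [red, hij]
  have hli : LinearIndependent k (fun i => (1 : k) ⊗ₜ[D] b i) := by
    refine LinearIndependent.of_comp ρk ?_
    have : (ρk ∘ fun i => (1 : k) ⊗ₜ[D] b i) = Pi.basisFun k (Fin m) := by
      funext i; simp [hρb]
    rw [this]
    exact (Pi.basisFun k (Fin m)).linearIndependent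
  have hsp : ⊤ ≤ Submodule.span k (Set.range fun i => (1 : k) ⊗ₜ[D] b i) := by
    rintro w -
    induction w using TensorProduct.induction_on with
    | zero => exact Submodule.zero_mem _
    | add v w hv hw => exact Submodule.add_mem _ hv hw
    | tmul c r =>
      obtain ⟨n, hn⟩ := hspan r
      have hne : algebraMap D k (f ^ n) ≠ 0 := by rw [map_pow]; exact pow_ne_zero _ hfk
      have h1 : ∀ q ∈ Submodule.span D (Set.range b),
          (1 : k) ⊗ₜ[D] q ∈ Submodule.span k (Set.range fun i => (1 : k) ⊗ₜ[D] b i) := by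
        intro q hq
        induction hq using Submodule.span_induction with
        | mem q hq => obtain ⟨i, rfl⟩ := hq; exact Submodule.subset_span ⟨i, rfl⟩
        | zero => simp
        | add p q _ _ hp hq => rw [TensorProduct.tmul_add]; exact Submodule.add_mem _ hp hq
        | smul d q _ hq =>
          rw [TensorProduct.tmul_smul, ← algebraMap_smul k d]; exact Submodule.smul_mem _ _ hq
      have h2 : c ⊗ₜ[D] r = (c * (algebraMap D k (f ^ n))⁻¹) • ((1 : k) ⊗ₜ[D] (f ^ n • r)) := by
        rw [TensorProduct.tmul_smul, ← algebraMap_smul k (f ^ n), smul_smul, mul_assoc,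
          inv_mul_cancel₀ hne, mul_one, TensorProduct.smul_tmul', smul_eq_mul, mul_one]
      rw [h2]
      exact Submodule.smul_mem _ _ (h1 _ hn)
  let B := Module.Basis.mk hli hsp
  exact ⟨Module.Finite.of_basis B, by rw [Module.finrank_eq_card_basis B, Fintype.card_fin]⟩

theorem formallyUnramified_tensorProduct_of_smul_eq_zero {f : D}
    (hΩ : ∀ w : Ω[R⁄D], f • w = 0) (hfk : algebraMap D k f ≠ 0) :
    Algebra.FormallyUnramified k (k ⊗[D] R) := by
  rw [Algebra.formallyUnramified_iff]
  let : Algebra R (k ⊗[D] R) := Algebra.TensorProduct.rightAlgebra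
  have hsub : Subsingleton (k ⊗[D] Ω[R⁄D]) := by
    refine subsingleton_of_forall_eq 0 fun w => ?_
    induction w using TensorProduct.induction_on with
    | zero => rfl
    | add v w hv hw => rw [hv, hw, add_zero]
    | tmul c w =>
      have h2 : c ⊗ₜ[D] w = (c * (algebraMap D k f)⁻¹) • ((1 : k) ⊗ₜ[D] (f • w)) := by
        rw [TensorProduct.tmul_smul, ← algebraMap_smul k f, smul_smul, mul_assoc,
          inv_mul_cancel₀ hfk, mul_one, TensorProduct.smul_tmul', smul_eq_mul, mul_one]
      rw [h2, hΩ, TensorProduct.tmul_zero, smul_zero]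
  exact (KaehlerDifferential.tensorKaehlerEquivBase D k R (k ⊗[D] R)).symm.toEquiv.subsingleton

/-- An unramified algebra over an algebraically closed field is étale, hence a product of copies
of the field. -/
theorem nonempty_algEquiv_pi [IsAlgClosed k] (F : Type*) [CommRing F] [Algebra k F]
    [Module.Finite k F] [Algebra.FormallyUnramified k F] :
    Nonempty (F ≃ₐ[k] (Fin (Module.finrank k F) → k)) := by
  have : Algebra.FormallyEtale k F := Algebra.FormallyEtale.of_formallyUnramified_of_field k F
  let e := Algebra.FormallyEtale.equivPiOfIsSepClosed k F
  have : IsArtinianRing F := isArtinian_of_tower k inferInstance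
  have : Fintype (PrimeSpectrum F) := Fintype.ofFinite _
  have hc : Fintype.card (PrimeSpectrum F) = Module.finrank k F := by
    rw [e.toLinearEquiv.finrank_eq, Module.finrank_fintype_fun_eq_card]
  exact ⟨e.trans (AlgEquiv.piCongrLeft k (fun _ => k) (Fintype.equivFinOfCardEq hc))⟩

end Specialization

/-! ### Reduction modulo a prime element and the tower ring -/

section Reduction

/-- The reduction `B / xB` of an `A`-algebra `B` modulo an element `x` of `A`. -/
abbrev ReductionMod {A : Type*} (B : Type*) [CommRing A] [CommRing B] [Algebra A B] (x : A) :
    Type _ :=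
  B ⧸ (Ideal.span {x}).map (algebraMap A B)

variable {A B : Type*} [CommRing A] [CommRing B] [Algebra A B]

theorem mem_map_span_singleton_iff {x : A} {b : B} :
    b ∈ (Ideal.span {x}).map (algebraMap A B) ↔ algebraMap A B x ∣ b := by
  rw [Ideal.map_span, Set.image_singleton, Ideal.mem_span_singleton]

theorem ReductionMod.mk_algebraMap (x a : A) :
    algebraMap (A ⧸ Ideal.span {x}) (ReductionMod B x) (Ideal.Quotient.mk _ a) =
      Ideal.Quotient.mk _ (algebraMap A B a) := rfl

instance (x : A) : IsScalarTower A (A ⧸ Ideal.span {x}) (ReductionMod B x) :=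
  IsScalarTower.of_algebraMap_eq fun _ => rfl

theorem algebraMap_quotient_span_eq_zero {x : A} {S : Type*} [CommRing S] [Algebra A S]
    [Algebra (A ⧸ Ideal.span {x}) S] [IsScalarTower A (A ⧸ Ideal.span {x}) S] :
    algebraMap A S x = 0 := by
  have : algebraMap A (A ⧸ Ideal.span {x}) x = 0 :=
    Ideal.Quotient.eq_zero_iff_mem.2 (Ideal.mem_span_singleton_self x)
  rw [IsScalarTower.algebraMap_apply A (A ⧸ Ideal.span {x}) S, this, map_zero]

theorem ReductionMod.exists_lift {x : A} {S : Type*} [CommRing S] [Algebra A S]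
    [Algebra (A ⧸ Ideal.span {x}) S] [IsScalarTower A (A ⧸ Ideal.span {x}) S] (φ : B →ₐ[A] S) :
    ∃ θ : ReductionMod B x →ₐ[A ⧸ Ideal.span {x}] S, ∀ b, θ (Ideal.Quotient.mk _ b) = φ b := by
  let F : ReductionMod B x →ₐ[A] S := Ideal.Quotient.liftₐ _ φ (by
    intro a ha
    obtain ⟨c, rfl⟩ := mem_map_span_singleton_iff.1 ha
    rw [map_mul, AlgHom.commutes, algebraMap_quotient_span_eq_zero, zero_mul])
  exact ⟨AlgHom.extendScalarsOfSurjective Ideal.Quotient.mk_surjective F, fun _ => rfl⟩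

/-- Algebraic independence modulo `x` lifts: a nontrivial relation over `A` can be divided by `x`
until its reduction is nonzero. -/
theorem algebraicIndependent_of_reductionMod [IsDomain A] [IsNoetherianRing A] [IsDomain B]
    (hinj : Function.Injective (algebraMap A B)) {x : A} (hx : Prime x) {ι : Type*} {b : ι → B}
    (h : AlgebraicIndependent (A ⧸ Ideal.span {x})
      (fun i => (Ideal.Quotient.mk _ (b i) : ReductionMod B x))) :
    AlgebraicIndependent A b := by
  rw [algebraicIndependent_iff] at h ⊢
  have hcomm : ∀ P : MvPolynomial ι A,
      (Ideal.Quotient.mk _ (MvPolynomial.aeval b P) : ReductionMod B x) =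
      MvPolynomial.aeval (fun i => (Ideal.Quotient.mk _ (b i) : ReductionMod B x))
        (MvPolynomial.map (Ideal.Quotient.mk (Ideal.span {x})) P) := by
    intro P
    rw [MvPolynomial.aeval_def, MvPolynomial.aeval_def, MvPolynomial.eval₂_map,
      ← MvPolynomial.coe_eval₂Hom, MvPolynomial.map_eval₂Hom]
    rfl
  -- a relation can be divided by `x` any number of times
  have hdiv : ∀ (n : ℕ) (P : MvPolynomial ι A), MvPolynomial.aeval b P = 0 →
      MvPolynomial.C (x ^ n) ∣ P := by
    intro n
    induction n with
    | zero => intro P _; simp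
    | succ n ih =>
      intro P hP
      have h0 := h _ ((hcomm P).symm.trans (by rw [hP, map_zero]))
      have h1 : MvPolynomial.C x ∣ P := by
        rw [MvPolynomial.C_dvd_iff_dvd_coeff]
        intro m
        have := congrArg (MvPolynomial.coeff m) h0
        rwa [MvPolynomial.coeff_map, MvPolynomial.coeff_zero, Ideal.Quotient.eq_zero_iff_mem,
          Ideal.mem_span_singleton] at this
      obtain ⟨Q, rfl⟩ := h1
      have hQ : MvPolynomial.aeval b Q = 0 := by
        rw [map_mul, MvPolynomial.aeval_C] at hP
        exact (mul_eq_zero.1 hP).resolve_left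
          ((map_ne_zero_iff _ hinj).2 hx.ne_zero)
      rw [pow_succ', map_mul]
      exact mul_dvd_mul_left _ (ih Q hQ)
  intro P hP
  by_contra hne
  obtain ⟨m, hm⟩ := MvPolynomial.ne_zero_iff.1 hne
  have hfin : FiniteMultiplicity x (MvPolynomial.coeff m P) :=
    FiniteMultiplicity.of_not_isUnit hx.not_isUnit hm
  obtain ⟨n, hn⟩ := hfin
  exact hn (MvPolynomial.C_dvd_iff_dvd_coeff _ _ |>.1 (hdiv (n + 1) P hP) m)

end Reduction

section ReductionTrdeg

variable {A B : Type u} [CommRing A] [CommRing B] [Algebra A B]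

/-- The special fibre over a prime element has transcendence degree at most that of the algebra.
This replaces the dimension theory of flat morphisms. -/
theorem trdeg_reductionMod_le [IsDomain A] [IsNoetherianRing A] [IsDomain B]
    (hinj : Function.Injective (algebraMap A B)) {x : A} (hx : Prime x) :
    Algebra.trdeg (A ⧸ Ideal.span {x}) (ReductionMod B x) ≤ Algebra.trdeg A B := by
  refine ciSup_le' fun ⟨s, hs⟩ => ?_
  have := algebraicIndependent_of_reductionMod (B := B) hinj hx
    (b := fun c : s => (c : ReductionMod B x).out)
    (by simpa [AlgebraicIndepOn] using hs)
  exact this.cardinalMk_le_trdeg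

/-- The variable of the polynomial ring already contributes one to the transcendence degree. -/
theorem isAlgebraic_of_trdeg_mvPolynomial_le_one {D R C : Type u} [CommRing D] [CommRing R]
    [CommRing C] [Algebra D R] [Algebra D C] [IsDomain D] [IsDomain R] [FaithfulSMul D R]
    (e : C ≃ₐ[D] MvPolynomial PUnit.{u + 1} R) (h : Algebra.trdeg D C ≤ 1) :
    Algebra.IsAlgebraic D R := by
  rw [← trdeg_eq_zero_iff]
  have h1 := trdeg_add_le (R := D) (S := R) (A := MvPolynomial PUnit.{u + 1} R)
  rw [MvPolynomial.trdeg_of_isDomain, ← e.trdeg_eq] at h1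
  have h2 := h1.trans h
  simp at h2
  by_contra h0
  have h3 := Cardinal.one_le_iff_ne_zero.2 h0
  have h4 : (1 : Cardinal) + 1 ≤ 1 := (add_le_add_left h3 1).trans h2
  norm_num at h4
end ReductionTrdeg

section Tower

variable {A : Type u} [CommRing A] {ν : ℕ} (x : A) (l : Fin ν → ℕ)
    (g : Fin ν → MvPolynomial (Fin (ν + 1)) A)

theorem TowerRing.relation (i : Fin ν) :
    algebraMap A (TowerRing x l g) (x ^ l i) * TowerRing.mk x l g (MvPolynomial.X i.succ) =
      TowerRing.mk x l g (g i) := by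
  have : TowerRing.mk x l g (MvPolynomial.C (x ^ l i) * MvPolynomial.X i.succ - g i) = 0 :=
    Ideal.Quotient.eq_zero_iff_mem.2 (Ideal.subset_span ⟨i, rfl⟩)
  rw [map_sub, map_mul, sub_eq_zero] at this
  rw [← this]
  rfl

/-- By induction, every `Y_i` is algebraic over `A[Z]`. -/
theorem TowerRing.trdeg_le_one [IsDomain (TowerRing x l g)]
    (hinj : Function.Injective (algebraMap A (TowerRing x l g))) (hx : x ≠ 0)
    (hg : ∀ i : Fin ν, g i ∈ MvPolynomial.supported A {j | j ≤ i.castSucc}) :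
    Algebra.trdeg A (TowerRing x l g) ≤ 1 := by
  set B := TowerRing x l g
  let z : B := TowerRing.mk x l g (MvPolynomial.X 0)
  have hxB : algebraMap A B x ≠ 0 := (map_ne_zero_iff _ hinj).2 hx
  let T : Subalgebra (Algebra.adjoin A {z}) B :=
    Subalgebra.algebraicClosure (Algebra.adjoin A {z}) B
  have hA_mem : ∀ a : A, algebraMap A B a ∈ T := fun a => by
    rw [IsScalarTower.algebraMap_apply A (Algebra.adjoin A {z}) B]
    exact T.algebraMap_mem _
  have hmem : ∀ (P : MvPolynomial (Fin (ν + 1)) A) (s : Set (Fin (ν + 1))),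
      P ∈ MvPolynomial.supported A s → (∀ j ∈ s, TowerRing.mk x l g (MvPolynomial.X j) ∈ T) →
      TowerRing.mk x l g P ∈ T := by
    intro P s hP hs
    rw [MvPolynomial.supported] at hP
    induction hP using Algebra.adjoin_induction with
    | mem p hp => obtain ⟨j, hj, rfl⟩ := hp; exact hs j hj
    | algebraMap a => rw [AlgHom.commutes]; exact hA_mem a
    | add p q _ _ hp hq => rw [map_add]; exact T.add_mem hp hq
    | mul p q _ _ hp hq => rw [map_mul]; exact T.mul_mem hp hq
  have hX : ∀ (n : ℕ) (j : Fin (ν + 1)), (j : ℕ) ≤ n →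
      TowerRing.mk x l g (MvPolynomial.X j) ∈ T := by
    intro n
    induction n with
    | zero =>
      intro j hj
      have : j = 0 := Fin.ext (by simpa using hj)
      subst this
      exact T.algebraMap_mem (⟨z, Algebra.subset_adjoin rfl⟩ : Algebra.adjoin A {z})
    | succ n ih =>
      intro j hj
      by_cases hj0 : j = 0
      · exact ih j (by simp [hj0])
      obtain ⟨i, rfl⟩ := Fin.exists_succ_eq.2 hj0
      have h1 : TowerRing.mk x l g (g i) ∈ T := hmem _ _ (hg i) fun k hk => ih k (by
        have : (k : ℕ) ≤ i := hk
        simp at hj; omega)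
      rw [← TowerRing.relation] at h1
      have hne : algebraMap A B (x ^ l i) ≠ 0 := by rw [map_pow]; exact pow_ne_zero _ hxB
      exact IsAlgebraic.of_mul (mem_nonZeroDivisors_of_ne_zero hne) (hA_mem _) h1
  have : Algebra.IsAlgebraic (Algebra.adjoin A {z}) B := ⟨fun b => by
    obtain ⟨P, rfl⟩ := Ideal.Quotient.mk_surjective b
    exact hmem P Set.univ (by simp) fun j _ => hX j j le_rfl⟩
  simpa using Algebra.IsAlgebraic.trdeg_le_cardinalMk A ({z} : Set B)

/-- Reduction of coefficients modulo `x`, together with the substitution of `0` for the last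
variable. -/
def dropLast : MvPolynomial (Fin (ν + 1)) A →ₐ[A] MvPolynomial (Fin ν) (A ⧸ Ideal.span {x}) :=
  MvPolynomial.aeval (Fin.lastCases 0 MvPolynomial.X)

/-- The ring `(A / xA)[Z, Y₁, …, Y_{ν-1}] / (g₀, …, g_{ν-1})`. The reduction of the tower ring
modulo `x` is a polynomial ring in `Y_ν` over it. -/
def TowerBase : Type u :=
  MvPolynomial (Fin ν) (A ⧸ Ideal.span {x}) ⧸
    (Ideal.span (Set.range fun i : Fin ν => dropLast x (g i)))

instance : CommRing (TowerBase x g) := inferInstanceAs (CommRing (_ ⧸ _))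

instance : Algebra (A ⧸ Ideal.span {x}) (TowerBase x g) :=
  inferInstanceAs (Algebra (A ⧸ Ideal.span {x}) (_ ⧸ _))

instance : Algebra A (TowerBase x g) := inferInstanceAs (Algebra A (_ ⧸ _))

instance : IsScalarTower A (A ⧸ Ideal.span {x}) (TowerBase x g) :=
  inferInstanceAs (IsScalarTower A (A ⧸ Ideal.span {x}) (_ ⧸ _))

/-- The residue class in the base of the tower of a polynomial in `Z, Y₁, …, Y_{ν-1}`. -/
def towerBaseMk : MvPolynomial (Fin ν) (A ⧸ Ideal.span {x}) →ₐ[A ⧸ Ideal.span {x}]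
    TowerBase x g where
  toRingHom := Ideal.Quotient.mk (Ideal.span (Set.range fun i : Fin ν => dropLast x (g i)))
  commutes' _ := rfl

instance : Algebra.FiniteType (A ⧸ Ideal.span {x}) (TowerBase x g) :=
  Algebra.FiniteType.of_surjective (towerBaseMk x g) Ideal.Quotient.mk_surjective

/-- A homomorphism to an algebra over `A / xA` can be evaluated on a polynomial without `Y_ν`
through its image under `dropLast`. -/
theorem algHom_eq_comp_dropLast {S : Type*} [CommRing S] [Algebra A S]
    [Algebra (A ⧸ Ideal.span {x}) S] [IsScalarTower A (A ⧸ Ideal.span {x}) S]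
    (φ : MvPolynomial (Fin (ν + 1)) A →ₐ[A] S)
    {p : MvPolynomial (Fin (ν + 1)) A} {i : Fin ν}
    (hp : p ∈ MvPolynomial.supported A {j | j ≤ i.castSucc}) :
    MvPolynomial.aeval (R := A ⧸ Ideal.span {x}) (fun k : Fin ν => φ (MvPolynomial.X k.castSucc))
      (dropLast x p) = φ p := by
  rw [MvPolynomial.supported] at hp
  induction hp using Algebra.adjoin_induction with
  | mem p hp =>
    obtain ⟨j, hj, rfl⟩ := hp
    obtain ⟨k, rfl⟩ : ∃ k : Fin ν, k.castSucc = j :=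
      Fin.exists_castSucc_eq.2 fun h => by
        have h1 : (j : ℕ) ≤ i := hj
        rw [h, Fin.val_last] at h1
        exact absurd i.2 (not_lt.2 h1)
    simp [dropLast]
  | algebraMap a =>
    rw [AlgHom.commutes, AlgHom.commutes, IsScalarTower.algebraMap_apply A (A ⧸ Ideal.span {x})
      (MvPolynomial _ _), AlgHom.commutes, ← IsScalarTower.algebraMap_apply]
  | add p q _ _ hp hq => rw [map_add, map_add, map_add, hp, hq]
  | mul p q _ _ hp hq => rw [map_mul, map_mul, map_mul, hp, hq]

variable {x g}

variable (x g) in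
/-- The class in `B / xB` of a polynomial in `Z, Y₁, …, Y_ν`. -/
def reductionMk : MvPolynomial (Fin (ν + 1)) A →ₐ[A] ReductionMod (TowerRing x l g) x :=
  (Ideal.Quotient.mkₐ A _).comp (TowerRing.mk x l g)

theorem reductionMk_surjective : Function.Surjective (reductionMk x l g) :=
  (Ideal.Quotient.mk_surjective).comp Ideal.Quotient.mk_surjective

variable {l}

theorem reductionMk_eq_zero (hl : ∀ i, 0 < l i) (i : Fin ν) : reductionMk x l g (g i) = 0 := by
  change Ideal.Quotient.mkₐ A _ (TowerRing.mk x l g (g i)) = 0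
  rw [← TowerRing.relation, map_mul, AlgHom.commutes, map_pow,
    algebraMap_quotient_span_eq_zero (S := ReductionMod (TowerRing x l g) x), zero_pow (hl i).ne',
    zero_mul]

theorem reductionMod_algHom_ext {S : Type*} [CommRing S] [Algebra A S]
    [Algebra (A ⧸ Ideal.span {x}) S] [IsScalarTower A (A ⧸ Ideal.span {x}) S]
    {φ ψ : ReductionMod (TowerRing x l g) x →ₐ[A ⧸ Ideal.span {x}] S}
    (h : ∀ j, φ (reductionMk x l g (MvPolynomial.X j)) = ψ (reductionMk x l g (MvPolynomial.X j))) :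
    φ = ψ := by
  have h1 : (φ.restrictScalars A).comp (reductionMk x l g) =
      (ψ.restrictScalars A).comp (reductionMk x l g) := MvPolynomial.algHom_ext h
  ext c
  obtain ⟨p, rfl⟩ := reductionMk_surjective l c
  exact DFunLike.congr_fun h1 p

theorem exists_reductionMod_lift (hl : ∀ i, 0 < l i) {S : Type*} [CommRing S] [Algebra A S]
    [Algebra (A ⧸ Ideal.span {x}) S] [IsScalarTower A (A ⧸ Ideal.span {x}) S]
    (φ : MvPolynomial (Fin (ν + 1)) A →ₐ[A] S) (hφ : ∀ i, φ (g i) = 0) :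
    ∃ F : ReductionMod (TowerRing x l g) x →ₐ[A ⧸ Ideal.span {x}] S,
      ∀ p, F (reductionMk x l g p) = φ p := by
  let φ₁ : TowerRing x l g →ₐ[A] S := Ideal.Quotient.liftₐ _ φ (by
    intro a ha
    refine (Ideal.span_le (I := RingHom.ker φ)).2 ?_ ha
    rintro _ ⟨i, rfl⟩
    change φ _ = 0
    rw [map_sub, map_mul, hφ, sub_zero, ← MvPolynomial.algebraMap_eq, AlgHom.commutes, map_pow,
      algebraMap_quotient_span_eq_zero, zero_pow (hl i).ne', zero_mul])
  obtain ⟨F, hF⟩ := ReductionMod.exists_lift (x := x) φ₁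
  exact ⟨F, fun p => hF _⟩

theorem exists_towerBase_lift {S : Type*} [CommRing S] [Algebra A S]
    [Algebra (A ⧸ Ideal.span {x}) S] [IsScalarTower A (A ⧸ Ideal.span {x}) S]
    (hg : ∀ i : Fin ν, g i ∈ MvPolynomial.supported A {j | j ≤ i.castSucc})
    (φ : MvPolynomial (Fin (ν + 1)) A →ₐ[A] S) (hφ : ∀ i, φ (g i) = 0) :
    ∃ ρ : TowerBase x g →ₐ[A ⧸ Ideal.span {x}] S,
      ∀ k, ρ (towerBaseMk x g (MvPolynomial.X k)) = φ (MvPolynomial.X k.castSucc) :=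
  ⟨Ideal.Quotient.liftₐ _ (MvPolynomial.aeval (R := A ⧸ Ideal.span {x})
      fun k : Fin ν => φ (MvPolynomial.X k.castSucc)) (by
    intro a ha
    refine (Ideal.span_le (I := RingHom.ker (MvPolynomial.aeval (R := A ⧸ Ideal.span {x})
      fun k : Fin ν => φ (MvPolynomial.X k.castSucc)))).2 ?_ ha
    rintro _ ⟨i, rfl⟩
    exact (algHom_eq_comp_dropLast x φ (hg i)).trans (hφ i)),
  fun k => MvPolynomial.aeval_X _ _⟩

/-- A homomorphism whose restriction to the first `ν` variables factors through the base of the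
tower kills all `g i`. -/
theorem eq_zero_of_towerBase_algHom {S : Type*} [CommRing S] [Algebra A S]
    [Algebra (A ⧸ Ideal.span {x}) S] [IsScalarTower A (A ⧸ Ideal.span {x}) S]
    (hg : ∀ i : Fin ν, g i ∈ MvPolynomial.supported A {j | j ≤ i.castSucc})
    (φ : MvPolynomial (Fin (ν + 1)) A →ₐ[A] S) (ρ : TowerBase x g →ₐ[A ⧸ Ideal.span {x}] S)
    (hρ : ∀ k, ρ (towerBaseMk x g (MvPolynomial.X k)) = φ (MvPolynomial.X k.castSucc))
    (i : Fin ν) : φ (g i) = 0 := by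
  rw [← algHom_eq_comp_dropLast x φ (hg i)]
  have : (MvPolynomial.aeval (R := A ⧸ Ideal.span {x})
      fun k : Fin ν => φ (MvPolynomial.X k.castSucc)) = ρ.comp (towerBaseMk x g) := by
    ext k : 1
    rw [MvPolynomial.aeval_X, ← hρ]
    rfl
  rw [this, AlgHom.comp_apply]
  have h0 : towerBaseMk x g (dropLast x (g i)) = 0 :=
    Ideal.Quotient.eq_zero_iff_mem.2 (Ideal.subset_span ⟨i, rfl⟩)
  rw [h0, map_zero]

theorem towerBase_algHom_ext {S : Type*} [CommRing S] [Algebra (A ⧸ Ideal.span {x}) S]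
    {φ ψ : TowerBase x g →ₐ[A ⧸ Ideal.span {x}] S}
    (h : ∀ k, φ (towerBaseMk x g (MvPolynomial.X k)) =
      ψ (towerBaseMk x g (MvPolynomial.X k))) : φ = ψ :=
  Ideal.Quotient.algHom_ext _ (MvPolynomial.algHom_ext h)

/-- `B / xB` is a polynomial ring in `Y_ν`: modulo `x` the relations become `g i = 0`, and none of
them involves `Y_ν`. -/
theorem exists_reductionMod_algEquiv (hl : ∀ i, 0 < l i)
    (hg : ∀ i : Fin ν, g i ∈ MvPolynomial.supported A {j | j ≤ i.castSucc}) :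
    ∃ e : ReductionMod (TowerRing x l g) x ≃ₐ[A ⧸ Ideal.span {x}]
        MvPolynomial PUnit.{u + 1} (TowerBase x g),
      ∀ k : Fin ν, e (reductionMk x l g (MvPolynomial.X k.castSucc)) =
        MvPolynomial.C (towerBaseMk x g (MvPolynomial.X k)) := by
  obtain ⟨ρ, hρ⟩ := exists_towerBase_lift (x := x) hg (reductionMk x l g) (reductionMk_eq_zero hl)
  let φ : MvPolynomial (Fin (ν + 1)) A →ₐ[A] MvPolynomial PUnit.{u + 1} (TowerBase x g) :=
    MvPolynomial.aeval (Fin.lastCases (MvPolynomial.X PUnit.unit)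
      fun k => MvPolynomial.C (towerBaseMk x g (MvPolynomial.X k)))
  have hφX : ∀ k : Fin ν, φ (MvPolynomial.X k.castSucc) =
      MvPolynomial.C (towerBaseMk x g (MvPolynomial.X k)) := fun k => by simp [φ]
  have hφL : φ (MvPolynomial.X (Fin.last ν)) = MvPolynomial.X PUnit.unit := by simp [φ]
  let κ : TowerBase x g →ₐ[A ⧸ Ideal.span {x}] MvPolynomial PUnit.{u + 1} (TowerBase x g) :=
    IsScalarTower.toAlgHom _ _ _
  have hφg : ∀ i, φ (g i) = 0 := fun i =>
    eq_zero_of_towerBase_algHom hg φ κ (fun k => (hφX k).symm) i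
  obtain ⟨F, hF⟩ := exists_reductionMod_lift (x := x) hl φ hφg
  let G := MvPolynomial.aevalTower (σ := PUnit.{u + 1}) ρ
    fun _ => reductionMk x l g (MvPolynomial.X (Fin.last ν))
  have hGC : ∀ r, G (MvPolynomial.C r) = ρ r := fun r => MvPolynomial.aevalTower_C _ _ _
  have hGX : G (MvPolynomial.X PUnit.unit) = reductionMk x l g (MvPolynomial.X (Fin.last ν)) :=
    MvPolynomial.aevalTower_X _ _ _
  refine ⟨AlgEquiv.ofAlgHom F G (MvPolynomial.algHom_ext' ?_ fun _ => ?_)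
    (reductionMod_algHom_ext fun j => ?_), fun k => (hF _).trans (hφX k)⟩
  · refine towerBase_algHom_ext fun k => ?_
    change F (G (MvPolynomial.C _)) = MvPolynomial.C _
    rw [hGC, hρ, hF, hφX]
  · change F (G (MvPolynomial.X _)) = MvPolynomial.X _
    rw [hGX, hF, hφL]
  · change G (F _) = reductionMk x l g _
    rw [hF]
    induction j using Fin.lastCases with
    | last => rw [hφL, hGX]
    | cast k => rw [hφX, hGC, hρ]

end Tower

/-! ### Fibre algebras -/

section FiberAlgebra

/-- The general geometric fibre of `R` over `D` is a disjoint union of `m` points; the rank `m`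
exceeds `1` as soon as some `z` in `R` does not lie in the fraction field of `D`. -/
theorem exists_forall_nonempty_tensorProduct_algEquiv_pi {D R : Type*} [CommRing D] [CommRing R]
    [Algebra D R] [IsDomain D] [IsDomain R] [CharZero D] [FaithfulSMul D R]
    [Algebra.FiniteType D R] [Algebra.IsAlgebraic D R] {z : R}
    (hz : ∀ s r : D, s ≠ 0 → s • z ≠ algebraMap D R r) :
    ∃ m : ℕ, 1 < m ∧ ∃ f : D, f ≠ 0 ∧ ∀ (k : Type u) [Field k] [IsAlgClosed k] [Algebra D k],
      algebraMap D k f ≠ 0 → Nonempty (k ⊗[D] R ≃ₐ[k] (Fin m → k)) := by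
  obtain ⟨m, b, f₁, hf₁, hb, hspan⟩ := exists_linearIndependent_span_away D R
  obtain ⟨f₂, hf₂, hΩ⟩ := exists_smul_kaehlerDifferential_eq_zero D R
  refine ⟨m, ?_, f₁ * f₂, mul_ne_zero hf₁ hf₂, fun k _ _ _ hk => ?_⟩
  · have hli : LinearIndependent D ![(1 : R), z] := by
      rw [LinearIndependent.pair_iff]
      intro s t hst
      have ht : t = 0 := by
        by_contra ht
        refine hz t (-s) ht ?_
        rw [map_neg, Algebra.algebraMap_eq_smul_one, eq_neg_iff_add_eq_zero, add_comm, hst]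
      rw [ht, zero_smul, add_zero, ← Algebra.algebraMap_eq_smul_one,
        FaithfulSMul.algebraMap_eq_zero_iff] at hst
      exact ⟨hst, ht⟩
    obtain ⟨n₀, h₀⟩ := hspan 1
    obtain ⟨n₁, h₁⟩ := hspan z
    let φ : R →ₗ[D] R := LinearMap.lsmul D R (f₁ ^ (n₀ + n₁))
    have hφ : Function.Injective φ := smul_right_injective R (pow_ne_zero _ hf₁)
    have := Fintype.ofFinite (Set.range b)
    have hli' := hli.map' φ (LinearMap.ker_eq_bot.2 hφ)
    have hle : Set.range (φ ∘ ![(1 : R), z]) ≤ Submodule.span D (Set.range b) := by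
      rintro _ ⟨i, rfl⟩
      fin_cases i
      · change f₁ ^ (n₀ + n₁) • (1 : R) ∈ _
        rw [add_comm, pow_add, mul_smul]
        exact Submodule.smul_mem _ _ h₀
      · change f₁ ^ (n₀ + n₁) • z ∈ _
        rw [pow_add, mul_smul]
        exact Submodule.smul_mem _ _ h₁
    have hcard := linearIndependent_le_span_aux' _ hli' (Set.range b) hle
    rw [Fintype.card_fin] at hcard
    have hcb := Fintype.card_le_of_surjective _ (Set.rangeFactorization_surjective (f := b))
    rw [Fintype.card_fin] at hcb
    exact hcard.trans hcb
  · rw [map_mul] at hk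
    obtain ⟨hfin, hrank⟩ := finrank_tensorProduct_of_span_away k hb hspan (left_ne_zero_of_mul hk)
    have := formallyUnramified_tensorProduct_of_smul_eq_zero k hΩ (right_ne_zero_of_mul hk)
    exact hrank ▸ nonempty_algEquiv_pi k (k ⊗[D] R)

/-- A polynomial over a finite power of `k` is a family of polynomials over `k`. -/
def MvPolynomial.piAlgEquiv (σ k ι : Type*) [CommRing k] [Fintype ι] :
    MvPolynomial σ (ι → k) ≃ₐ[k] (ι → MvPolynomial σ k) :=
  AlgEquiv.ofBijective
    (AlgHom.pi fun i => MvPolynomial.mapAlgHom (Pi.evalAlgHom k (fun _ => k) i)) <| by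
    classical
    have hcoeff : ∀ (p : MvPolynomial σ (ι → k)) (i : ι) (m : σ →₀ ℕ),
        MvPolynomial.coeff m (AlgHom.pi (fun i => MvPolynomial.mapAlgHom (σ := σ)
          (Pi.evalAlgHom k (fun _ => k) i)) p i) = MvPolynomial.coeff m p i := fun p i m =>
      MvPolynomial.coeff_map _ _ _
    refine ⟨fun p q hpq => ?_, fun q => ?_⟩
    · ext m i
      rw [← hcoeff, hpq, hcoeff]
    · refine ⟨∑ m ∈ Finset.univ.biUnion fun i => (q i).support,
        MvPolynomial.monomial m fun i => MvPolynomial.coeff m (q i), ?_⟩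
      funext i
      ext m
      rw [hcoeff, MvPolynomial.coeff_sum]
      simp only [MvPolynomial.coeff_monomial, Finset.sum_ite_eq']
      split_ifs with h
      · rfl
      · simp only [Finset.mem_biUnion, Finset.mem_univ, true_and, not_exists,
          MvPolynomial.notMem_support_iff] at h
        exact (h i).symm

/-- The fibres of an algebra that is a polynomial algebra over `R`, at a point where the fibre of
`R` is split. -/
def fiberAlgEquiv {D R C k σ ι : Type*} [CommRing D] [CommRing R] [CommRing C] [CommRing k]
    [Algebra D R] [Algebra D C] [Algebra D k] [Fintype ι]
    (e : C ≃ₐ[D] MvPolynomial σ R) (ε : k ⊗[D] R ≃ₐ[k] (ι → k)) :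
    k ⊗[D] C ≃ₐ[k] (ι → MvPolynomial σ k) :=
  (Algebra.TensorProduct.congr AlgEquiv.refl e).trans
    (MvPolynomial.rTensorAlgEquiv.trans
      ((MvPolynomial.mapAlgEquiv σ ε).trans (MvPolynomial.piAlgEquiv σ k ι)))

theorem isAlgClosed_residueField {K D : Type*} [Field K] [IsAlgClosed K] [CommRing D] [Algebra K D]
    [Algebra.FiniteType K D] (p : Ideal D) [p.IsMaximal] : IsAlgClosed p.ResidueField := by
  have h1 : Function.Surjective (algebraMap D p.ResidueField) :=
    Ideal.algebraMap_residueField_surjective p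
  have : Algebra.FiniteType K p.ResidueField :=
    Algebra.FiniteType.of_surjective (IsScalarTower.toAlgHom K D p.ResidueField) h1
  have : Module.Finite K p.ResidueField := finite_of_finite_type_of_isJacobsonRing K p.ResidueField
  have hbij : Function.Bijective (algebraMap K p.ResidueField) :=
    IsAlgClosed.algebraMap_bijective_of_isIntegral
  let e : K ≃+* p.ResidueField := RingEquiv.ofBijective _ hbij
  refine IsAlgClosed.of_exists_root _ fun P _ hP => ?_
  obtain ⟨y, hy⟩ := IsAlgClosed.exists_root (P.map (e.symm : p.ResidueField →+* K)) (by
    rw [Polynomial.degree_map]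
    exact (Polynomial.degree_pos_of_irreducible hP).ne')
  refine ⟨e y, ?_⟩
  have h := congrArg (e : K →+* p.ResidueField) hy
  rwa [Polynomial.eval_map, Polynomial.hom_eval₂, map_zero,
    RingEquiv.comp_symm, Polynomial.eval₂_id] at h

end FiberAlgebra

/-! ### Prime elements and faithful flatness -/

section Prime

variable {A B : Type u} [CommRing A] [CommRing B] [Algebra A B] [Module.FaithfullyFlat A B]

theorem algebraMap_injective_of_faithfullyFlat : Function.Injective (algebraMap A B) :=
  FaithfulSMul.algebraMap_injective A B

theorem algebraMap_dvd_algebraMap_iff {x a : A} :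
    algebraMap A B x ∣ algebraMap A B a ↔ x ∣ a := by
  rw [← mem_map_span_singleton_iff, ← Ideal.mem_comap, Ideal.comap_map_eq_self_of_faithfullyFlat,
    Ideal.mem_span_singleton]

/-- Factorial closedness makes `x` irreducible in `B`, and faithful flatness makes it a nonunit;
in a factorial domain it is then prime. -/
theorem prime_algebraMap_of_isFactoriallyClosed [IsDomain A] [IsDomain B]
    [UniqueFactorizationMonoid B] (h : IsFactoriallyClosed A B) {x : A} (hx : Prime x) :
    Prime (algebraMap A B x) := by
  have hinj : Function.Injective (algebraMap A B) := algebraMap_injective_of_faithfullyFlat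
  have hne : algebraMap A B x ≠ 0 := by simpa using hx.ne_zero
  refine UniqueFactorizationMonoid.irreducible_iff_prime.1 ⟨fun hu => ?_, fun b c hbc => ?_⟩
  · have : algebraMap A B x ∣ algebraMap A B 1 := by rw [map_one]; exact hu.dvd
    exact hx.not_isUnit (isUnit_of_dvd_one (algebraMap_dvd_algebraMap_iff.1 this))
  · obtain ⟨⟨b, rfl⟩, ⟨c, rfl⟩⟩ := h b c (hbc ▸ hne) (hbc ▸ ⟨x, rfl⟩)
    rw [← map_mul] at hbc
    exact (hx.irreducible.isUnit_or_isUnit (hinj hbc)).imp (fun h => h.map _) fun h => h.map _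

/-- Faithful flatness descends divisibility by a denominator `s` modulo `x`. -/
theorem exists_dvd_sub_of_dvd_mul_sub {x s r : A} {z : B} (hx : Prime (algebraMap A B x))
    (hs : ¬ x ∣ s) (h : algebraMap A B x ∣ algebraMap A B s * z - algebraMap A B r) :
    ∃ a : A, algebraMap A B x ∣ z - algebraMap A B a := by
  obtain ⟨w, hw⟩ := h
  have hr : r ∈ ((Ideal.span {s, x} : Ideal A).map (algebraMap A B)).comap (algebraMap A B) := by
    have hI : ∀ a ∈ (Ideal.span {s, x} : Ideal A),
        algebraMap A B a ∈ (Ideal.span {s, x} : Ideal A).map (algebraMap A B) := fun a ha =>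
      Ideal.mem_map_of_mem _ ha
    rw [Ideal.mem_comap, ← sub_sub_cancel (algebraMap A B s * z) (algebraMap A B r), hw]
    exact Ideal.sub_mem _ (Ideal.mul_mem_right _ _ (hI s (Ideal.subset_span (by simp))))
      (Ideal.mul_mem_right _ _ (hI x (Ideal.subset_span (by simp))))
  rw [Ideal.comap_map_eq_self_of_faithfullyFlat, Ideal.mem_span_pair] at hr
  obtain ⟨a, c, rfl⟩ := hr
  refine ⟨a, (hx.dvd_or_dvd (?_ : algebraMap A B x ∣ algebraMap A B s * _)).resolve_left
    fun h => hs (algebraMap_dvd_algebraMap_iff.1 h)⟩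
  refine ⟨w + algebraMap A B c, ?_⟩
  rw [mul_add, ← hw, map_add, map_mul, map_mul]
  ring

end Prime

/-! ### Affine lines over affine schemes -/

section Schemes

/-- Being a disjoint union of affine lines is invariant under isomorphism of arrows, where the base
may change too. -/
theorem IsDisjointUnionOfAffineLines.of_arrow_iso {F S F' S' : Scheme.{u}} {m : ℕ} {f : F ⟶ S}
    {f' : F' ⟶ S'} (i : Arrow.mk f ≅ Arrow.mk f') (h : IsDisjointUnionOfAffineLines m f') :
    IsDisjointUnionOfAffineLines m f := by
  obtain ⟨e, he⟩ := h
  let s : S' ≅ S := (Arrow.rightFunc.mapIso i).symm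
  let t : F ≅ F' := Arrow.leftFunc.mapIso i
  have hts : t.hom ≫ f' ≫ s.hom = f := by
    have h1 : i.hom.left ≫ f' = f ≫ i.hom.right := i.hom.w
    have h2 : i.hom.right ≫ i.inv.right = 𝟙 S := by rw [← Arrow.comp_right, i.hom_inv_id]; rfl
    change i.hom.left ≫ f' ≫ i.inv.right = f
    rw [reassoc_of% h1, h2, Category.comp_id]
  let α : affineLine S' ≅ affineLine S :=
    ⟨AffineSpace.map _ s.hom, AffineSpace.map _ s.inv, by
      rw [← AffineSpace.map_comp, Iso.hom_inv_id, AffineSpace.map_id], by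
      rw [← AffineSpace.map_comp, Iso.inv_hom_id, AffineSpace.map_id]⟩
  refine ⟨t ≪≫ e ≪≫ Sigma.mapIso fun _ => α, ?_⟩
  have hdesc : (Sigma.mapIso fun _ : Fin m => α).hom ≫
      Sigma.desc (fun _ : Fin m => (affineLine S ↘ S)) =
      Sigma.desc (fun _ : Fin m => (affineLine S' ↘ S')) ≫ s.hom := by
    refine Sigma.hom_ext _ _ fun j => ?_
    simp [α]
  rw [Iso.trans_hom, Iso.trans_hom, Category.assoc, Category.assoc, hdesc, reassoc_of% he, hts]

theorem isDisjointUnionOfAffineLines_of_algEquiv {k F : Type u} [CommRing k] [CommRing F]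
    [Algebra k F] {m : ℕ} (e : F ≃ₐ[k] (Fin m → MvPolynomial PUnit.{u + 1} k)) :
    IsDisjointUnionOfAffineLines m (Spec.map (CommRingCat.ofHom (algebraMap k F))) := by
  let P : CommRingCat.{u} := .of (MvPolynomial PUnit.{u + 1} k)
  -- coproducts of spectra are spectra of products when the index type lies in the universe `u`
  let e' : F ≃+* (ULift.{u} (Fin m) → P) :=
    e.toRingEquiv.trans (RingEquiv.piCongrLeft' (fun _ => P) Equiv.ulift.symm)
  let i : (∐ fun _ : Fin m => affineLine (Spec (.of k))) ≅ Spec (.of F) :=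
    (Sigma.mapIso fun _ : Fin m => AffineSpace.SpecIso PUnit.{u + 1} (.of k)) ≪≫
      (Sigma.reindex Equiv.ulift.{u} (fun _ : Fin m => Spec P)).symm ≪≫
      asIso (sigmaSpec fun _ : ULift.{u} (Fin m) => P) ≪≫
      Scheme.Spec.mapIso e'.toCommRingCatIso.op
  refine ⟨i.symm, ?_⟩
  rw [Iso.symm_hom, Iso.inv_comp_eq]
  refine Sigma.hom_ext _ _ fun j => ?_
  have h : CommRingCat.ofHom (algebraMap k F) ≫ CommRingCat.ofHom (e' : F →+* _) ≫
      CommRingCat.ofHom (Pi.evalRingHom (fun _ : ULift.{u} (Fin m) => P) ⟨j⟩) =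
      CommRingCat.ofHom (MvPolynomial.C : k →+* MvPolynomial PUnit.{u + 1} k) := by
    exact CommRingCat.hom_ext (RingHom.ext fun a => congrFun (e.commutes a) j)
  have hr : Sigma.ι (fun _ : Fin m => Spec P) j ≫
      (Sigma.reindex Equiv.ulift.{u} (fun _ : Fin m => Spec P)).inv =
      Sigma.ι (fun _ : ULift.{u} (Fin m) => Spec P) ⟨j⟩ := by
    exact Sigma.ι_reindex_inv Equiv.ulift.{u} (fun _ : Fin m => Spec P) ⟨j⟩
  have hi : Sigma.ι (fun _ : Fin m => affineLine (Spec (.of k))) j ≫ i.hom =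
      (AffineSpace.SpecIso PUnit.{u + 1} (.of k)).hom ≫
        Spec.map (CommRingCat.ofHom (Pi.evalRingHom (fun _ : ULift.{u} (Fin m) => P) ⟨j⟩)) ≫
          Spec.map (CommRingCat.ofHom (e' : F →+* _)) := by
    rw [← ι_sigmaSpec, Category.assoc, ← hr]
    simp [i]
    rfl
  rw [reassoc_of% hi, ← Spec.map_comp, ← Spec.map_comp, Category.assoc, h, Sigma.ι_desc]
  exact ((Iso.inv_comp_eq _).1 (AffineSpace.SpecIso_inv_over (.of k)))

theorem nonempty_algEquiv_of_isTrivialAffineLineBundle {A B : Type u} [CommRing A] [CommRing B]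
    [Algebra A B] (h : IsTrivialAffineLineBundle (structureMorphism A B)) :
    Nonempty (B ≃ₐ[A] MvPolynomial PUnit.{u + 1} A) := by
  obtain ⟨e, he⟩ := h
  let i : Spec (.of (MvPolynomial PUnit.{u + 1} A)) ≅ Spec (.of B) :=
    (AffineSpace.SpecIso PUnit.{u + 1} (.of A)).symm ≪≫ e.symm
  have hi : i.hom ≫ structureMorphism A B =
      Spec.map (CommRingCat.ofHom (MvPolynomial.C (σ := PUnit.{u + 1}))) := by
    rw [← he]
    simp [i]
  let j : CommRingCat.of B ≅ CommRingCat.of (MvPolynomial PUnit.{u + 1} A) :=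
    (Spec.fullyFaithful.preimageIso i).unop
  have hj : Spec.map j.hom = i.hom := Spec.fullyFaithful.map_preimage i.hom
  refine ⟨AlgEquiv.ofRingEquiv (f := j.commRingCatIsoToRingEquiv) fun a => ?_⟩
  rw [structureMorphism, ← hj, ← Spec.map_comp] at hi
  have := congrArg (fun φ => φ.hom a) (Spec.map_injective hi)
  exact this

end Schemes

/-! ### General fibres and triviality -/

theorem MvPolynomial.exists_eq_C_of_isAlgebraic {σ D : Type*} [Unique σ] [CommRing D] [IsDomain D]
    {p : MvPolynomial σ D} (hp : IsAlgebraic D p) : ∃ d, p = MvPolynomial.C d := by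
  have h1 := hp.algHom (MvPolynomial.uniqueAlgEquiv D σ).toAlgHom
  have h2 : (MvPolynomial.uniqueAlgEquiv D σ p).natDegree = 0 := by
    by_contra h
    refine Polynomial.transcendental _ h (mem_nonZeroDivisors_of_ne_zero ?_) h1
    rw [Ne, Polynomial.leadingCoeff_eq_zero]
    rintro h0
    rw [h0, Polynomial.natDegree_zero] at h
    exact h rfl
  refine ⟨(MvPolynomial.uniqueAlgEquiv D σ p).coeff 0, 
    (MvPolynomial.uniqueAlgEquiv D σ).injective ?_⟩
  rw [← MvPolynomial.algebraMap_eq, AlgEquiv.commutes]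
  exact Polynomial.eq_C_of_natDegree_eq_zero h2

/-- In a polynomial ring `A[T]`, an element that is algebraic over `A / xA` modulo `x` is
congruent to a constant. -/
theorem exists_dvd_sub_of_algEquiv_of_isAlgebraic {A B : Type*} [CommRing A] [CommRing B]
    [Algebra A B] {σ : Type*} [Unique σ] (ψ : B ≃ₐ[A] MvPolynomial σ A) {x : A} (hx : Prime x)
    {z : B} (hz : IsAlgebraic (A ⧸ Ideal.span {x}) (Ideal.Quotient.mk _ z : ReductionMod B x)) :
    ∃ a : A, algebraMap A B x ∣ z - algebraMap A B a := by
  have hprime : (Ideal.span {x}).IsPrime := (Ideal.span_singleton_prime hx.ne_zero).2 hx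
  let red : MvPolynomial σ A →ₐ[A] MvPolynomial σ (A ⧸ Ideal.span {x}) :=
    MvPolynomial.mapAlgHom (Ideal.Quotient.mkₐ A (Ideal.span {x}))
  obtain ⟨θ, hθ⟩ := ReductionMod.exists_lift (x := x) (red.comp (ψ : B →ₐ[A] MvPolynomial σ A))
  obtain ⟨d, hd⟩ := MvPolynomial.exists_eq_C_of_isAlgebraic (hz.algHom θ)
  obtain ⟨a, rfl⟩ := Ideal.Quotient.mk_surjective d
  have h0 : red (ψ (z - algebraMap A B a)) = 0 := by
    have h1 : red (ψ z) = MvPolynomial.C (Ideal.Quotient.mk _ a) := (hθ z).symm.trans hd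
    rw [map_sub, map_sub, h1, AlgEquiv.commutes, AlgHom.commutes]
    exact sub_self _
  have h2 : MvPolynomial.C x ∣ ψ (z - algebraMap A B a) :=
    (MvPolynomial.C_dvd_iff_map_hom_eq_zero (Ideal.Quotient.mk (Ideal.span {x})) x
      (fun r => by rw [Ideal.Quotient.eq_zero_iff_mem, Ideal.mem_span_singleton]) _).2 h0
  obtain ⟨w, hw⟩ := h2
  refine ⟨a, ψ.symm w, ψ.injective ?_⟩
  rw [hw, map_mul, AlgEquiv.commutes, AlgEquiv.apply_symm_apply, MvPolynomial.algebraMap_eq]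

/-- By the Nullstellensatz, the residue fields of closed points are algebraically closed, so that
the hypothesis applies to the closed points of the basic open set of `f`. -/
theorem generalFiberIsDisjointUnionOfAffineLines_of_tensorProduct {K : Type*} [Field K]
    [IsAlgClosed K] {D R C : Type u} [CommRing D] [CommRing R] [CommRing C] [Algebra K D]
    [Algebra.FiniteType K D] [Algebra D R] [Algebra D C] [IsDomain D]
    (e : C ≃ₐ[D] MvPolynomial PUnit.{u + 1} R) {m : ℕ} {f : D}
    (hf : f ≠ 0) (h : ∀ (k : Type u) [Field k] [IsAlgClosed k] [Algebra D k],
      algebraMap D k f ≠ 0 → Nonempty (k ⊗[D] R ≃ₐ[k] (Fin m → k))) :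
    GeneralFiberIsDisjointUnionOfAffineLines m
      (Spec.map (CommRingCat.ofHom (algebraMap D C))) := by
  refine ⟨PrimeSpectrum.basicOpen f, ?_, fun y hy hcl => ?_⟩
  · refine IsOpen.dense (X := PrimeSpectrum D) (PrimeSpectrum.basicOpen f).isOpen ⟨⊥, ?_⟩
    exact fun h0 => hf h0
  · let p : PrimeSpectrum D := y
    have : p.asIdeal.IsMaximal := (PrimeSpectrum.isClosed_singleton_iff_isMaximal p).1 hcl
    have : IsAlgClosed p.asIdeal.ResidueField := isAlgClosed_residueField (K := K) p.asIdeal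
    obtain ⟨ε⟩ := h p.asIdeal.ResidueField fun h0 =>
      hy (Ideal.algebraMap_residueField_eq_zero.1 h0)
    exact (isDisjointUnionOfAffineLines_of_algEquiv (fiberAlgEquiv e ε)).of_arrow_iso
      (Spec.fiberToSpecResidueFieldIso D C p)

end

theorem proposition3p7 {A : Type u} [CommRing A] [IsDomain A] [Algebra ℂ A]
    [Algebra.FiniteType ℂ A] (ν : ℕ) (hν : 0 < ν) (x : A) (hx : Prime x)
    (l : Fin ν → ℕ) (hl : ∀ i, 0 < l i)
    -- `g 0` is `g(Z)`, and `g i` is `g_i(Z, Y₁, …, Y_i)`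
    (g : Fin ν → MvPolynomial (Fin (ν + 1)) A)
    (hg : ∀ i : Fin ν, g i ∈ MvPolynomial.supported A {j | j ≤ i.castSucc} ∧
      g i ∉ MvPolynomial.supported A {j | j < i.castSucc})
    (hdom : IsDomain (TowerRing x l g))
    (hufd : UniqueFactorizationMonoid (TowerRing x l g))
    (hflat : Module.FaithfullyFlat A (TowerRing x l g))
    (hclosed : IsFactoriallyClosed A (TowerRing x l g))
    (hz : ∀ a : A, TowerRing.mk x l g (MvPolynomial.X 0) - algebraMap A (TowerRing x l g) a ∉
      (Ideal.span {algebraMap A (TowerRing x l g) x} : Ideal (TowerRing x l g)))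
    -- with the convention that `y_0 = z` and `g_0 = g` when `ν = 1`
    (hder : TowerRing.mk x l g
        (MvPolynomial.pderiv (⟨ν - 1, by omega⟩ : Fin ν).castSucc (g ⟨ν - 1, by omega⟩)) ∉
      (Ideal.span {algebraMap A (TowerRing x l g) x} : Ideal (TowerRing x l g))) :
    (∃ m : ℕ, 1 < m ∧ GeneralFiberIsDisjointUnionOfAffineLines m
      (restrictedMorphism A (TowerRing x l g) x)) ∧
    ¬ IsTrivialAffineLineBundle (structureMorphism A (TowerRing x l g)) := by
  have hz' : ∀ a : A, ¬ algebraMap A (TowerRing x l g) x ∣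
      TowerRing.mk x l g (MvPolynomial.X 0) - algebraMap A (TowerRing x l g) a := fun a h =>
    hz a (Ideal.mem_span_singleton.2 h)
  have hxB : Prime (algebraMap A (TowerRing x l g) x) :=
    prime_algebraMap_of_isFactoriallyClosed hclosed hx
  have hpD : (Ideal.span {x}).IsPrime := (Ideal.span_singleton_prime hx.ne_zero).2 hx
  have hpC : ((Ideal.span {x}).map (algebraMap A (TowerRing x l g))).IsPrime := by
    rw [Ideal.map_span, Set.image_singleton]
    exact (Ideal.span_singleton_prime hxB.ne_zero).2 hxB
  have hinj : Function.Injective (algebraMap A (TowerRing x l g)) :=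
    algebraMap_injective_of_faithfullyFlat
  have hnoeth : IsNoetherianRing A := Algebra.FiniteType.isNoetherianRing ℂ A
  have hchar : CharZero (A ⧸ Ideal.span {x}) :=
    charZero_of_injective_algebraMap (algebraMap ℂ (A ⧸ Ideal.span {x})).injective
  obtain ⟨e, he⟩ := exists_reductionMod_algEquiv (x := x) hl fun i => (hg i).1
  have hinjC : Function.Injective
      (algebraMap (A ⧸ Ideal.span {x}) (ReductionMod (TowerRing x l g) x)) := by
    rw [injective_iff_map_eq_zero]
    intro d hd
    obtain ⟨a, rfl⟩ := Ideal.Quotient.mk_surjective d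
    rw [ReductionMod.mk_algebraMap, Ideal.Quotient.eq_zero_iff_mem, mem_map_span_singleton_iff,
      algebraMap_dvd_algebraMap_iff] at hd
    rwa [Ideal.Quotient.eq_zero_iff_mem, Ideal.mem_span_singleton]
  have hdomP : IsDomain (MvPolynomial PUnit.{u + 1} (TowerBase x g)) :=
    e.symm.injective.isDomain e.symm.toRingHom
  have hdomR : IsDomain (TowerBase x g) :=
    (MvPolynomial.C_injective PUnit.{u + 1} (TowerBase x g)).isDomain MvPolynomial.C
  have hfaith : FaithfulSMul (A ⧸ Ideal.span {x}) (TowerBase x g) := by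
    rw [faithfulSMul_iff_algebraMap_injective]
    intro a b hab
    refine hinjC (e.injective ?_)
    rw [e.commutes, e.commutes, IsScalarTower.algebraMap_apply _ (TowerBase x g), hab,
      ← IsScalarTower.algebraMap_apply]
  have halg : Algebra.IsAlgebraic (A ⧸ Ideal.span {x}) (TowerBase x g) :=
    isAlgebraic_of_trdeg_mvPolynomial_le_one e
      ((trdeg_reductionMod_le hinj hx).trans
        (TowerRing.trdeg_le_one x l g hinj hx.ne_zero fun i => (hg i).1))
  -- the class of `Z` in `B / xB` comes from the base of the tower
  let z : TowerBase x g := towerBaseMk x g (MvPolynomial.X ⟨0, hν⟩)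
  have hez : e (Ideal.Quotient.mk _ (TowerRing.mk x l g (MvPolynomial.X 0))) = MvPolynomial.C z :=
    he ⟨0, hν⟩
  refine ⟨?_, fun htriv => ?_⟩
  · obtain ⟨m, hm, f, hf, hfib⟩ := exists_forall_nonempty_tensorProduct_algEquiv_pi.{u}
      (D := A ⧸ Ideal.span {x}) (z := z) fun s r hs hsr => by
        obtain ⟨s, rfl⟩ := Ideal.Quotient.mk_surjective s
        obtain ⟨r, rfl⟩ := Ideal.Quotient.mk_surjective r
        have h1 : (Ideal.Quotient.mk _ (algebraMap A (TowerRing x l g) s *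
            TowerRing.mk x l g (MvPolynomial.X 0)) : ReductionMod (TowerRing x l g) x) =
              Ideal.Quotient.mk _ (algebraMap A (TowerRing x l g) r) := by
          apply e.injective
          rw [map_mul, map_mul, hez, ← ReductionMod.mk_algebraMap, ← ReductionMod.mk_algebraMap,
            e.commutes, e.commutes,
            IsScalarTower.algebraMap_apply _ (TowerBase x g) (MvPolynomial _ _)
              (Ideal.Quotient.mk _ r), ← hsr, Algebra.smul_def, map_mul,
            ← IsScalarTower.algebraMap_apply, MvPolynomial.algebraMap_eq]
        rw [Ideal.Quotient.eq, mem_map_span_singleton_iff] at h1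
        obtain ⟨a, ha⟩ := exists_dvd_sub_of_dvd_mul_sub hxB (fun h => hs
          (Ideal.Quotient.eq_zero_iff_mem.2 (Ideal.mem_span_singleton.2 h))) h1
        exact hz' a ha
    exact ⟨m, hm, generalFiberIsDisjointUnionOfAffineLines_of_tensorProduct (K := ℂ) e hf hfib⟩
  · obtain ⟨ψ⟩ := nonempty_algEquiv_of_isTrivialAffineLineBundle htriv
    have hzalg : IsAlgebraic (A ⧸ Ideal.span {x}) (Ideal.Quotient.mk _
        (TowerRing.mk x l g (MvPolynomial.X 0)) : ReductionMod (TowerRing x l g) x) := by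
      have h1 : IsAlgebraic (A ⧸ Ideal.span {x}) (MvPolynomial.C (σ := PUnit.{u + 1}) z) :=
        (Algebra.IsAlgebraic.isAlgebraic (R := A ⧸ Ideal.span {x}) z).algebraMap
      have h2 := h1.algHom e.symm.toAlgHom
      rw [← hez] at h2
      simpa using h2
    obtain ⟨a, ha⟩ := exists_dvd_sub_of_algEquiv_of_isAlgebraic ψ hx hzalg
    exact hz' a ha
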